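/- Let $G$ be a finite simple graph with at least one vertex, all of whose connected components have at least $3$ vertices. For an Abelian group $\mathcal G$ (written additively) and an edge labelling $f:E(G)\to\mathcal G$, put $w(v)=\sum_{e\ni v}f(e)$ for each vertex $v$; $f$ is called vertex-$\mathcal G$-colouring if $w(u)\neq w(v)$ for all adjacent vertices $u,v$. Let $\chi^\Sigma_g(G)$ be the smallest positive integer $s$ such that for every Abelian group $\mathcal G$ of order $s$ there is a vertex-$\mathcal G$-colouring labelling of $G$. A connected graph $H$ with at least $3$ vertices is called ugly if either (i) $\chi(H)=4k+2$ for some integer $k\ge 0$ and in each proper $\chi(H)$-colouring of $H$ all colour classes have odd size, or (ii) $\chi(H)=2^q$ for some integer $q\ge 2$ and in each proper $\chi(H)$-colouring of $H$ either exactly $2$ or exactly $2^q-2$ colour classes have odd size. If $G$ has no ugly component $C$ with $\chi(C)=\chi(G)$, and it is not the case that $\chi(G)=2^q$ for some integer $q\ge 2$ while some component of $G$ is isomorphic to the complete graph $K_{\chi(G)-2}$, then $$\chi^\Sigma_g(G)=\chi(G).$$ Otherwise $$\chi^\Sigma_g(G)=\chi(G)+1.$$ -/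

import Mathlib

open Classical in
/-- The weighted degree `w(v) = ∑_{e ∋ v} f(e)` of the vertex `v` under the edge labelling `f`. -/
noncomputable def SimpleGraph.weightedDegree {V A : Type*} [Fintype V] [AddCommGroup A]
    (G : SimpleGraph V) (f : G.edgeSet → A) (v : V) : A :=
  ∑ e : G.edgeSet with v ∈ e.1, f e

/-- The edge labelling `f` is vertex-`A`-colouring: the weighted degrees of adjacent vertices are
distinct. -/
def SimpleGraph.IsVertexColouringLabelling {V A : Type*} [Fintype V] [AddCommGroup A]
    (G : SimpleGraph V) (f : G.edgeSet → A) : Prop :=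
  ∀ u v : V, G.Adj u v → G.weightedDegree f u ≠ G.weightedDegree f v

/-- Every Abelian group of order `s` admits a vertex-colouring edge labelling of `G`. As groups of
order `s > 0` are finite, each of them is isomorphic to one whose carrier lives in `Type`. -/
def SimpleGraph.HasGroupLabellings {V : Type*} [Fintype V] (G : SimpleGraph V) (s : ℕ) : Prop :=
  ∀ (A : Type) [AddCommGroup A] [Finite A], Nat.card A = s →
    ∃ f : G.edgeSet → A, G.IsVertexColouringLabelling f

/-- The group sum chromatic number: the smallest positive integer `s` such that every Abelian group
of order `s` admits a vertex-colouring edge labelling of `G` (`⊤` if there is none). There are no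
groups of order `0`, so `s = 0` has to be left out. -/
noncomputable def SimpleGraph.groupSumChromaticNumber {V : Type*} [Fintype V]
    (G : SimpleGraph V) : ℕ∞ :=
  ⨅ s ∈ {s : ℕ | 0 < s ∧ G.HasGroupLabellings s}, (s : ℕ∞)

/-- The number of colours whose colour class has odd size. -/
noncomputable def SimpleGraph.Coloring.numOddClasses {V α : Type*} {G : SimpleGraph V}
    (c : G.Coloring α) : ℕ :=
  {i : α | Odd (c.colorClass i).ncard}.ncard

/-- Ugly graphs (for finite `V`): connected graphs of order at least `3` such that
* `χ(G) = 4k + 2` and in each proper `χ(G)`-colouring all colour classes are odd, or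
* `χ(G) = 2 ^ q` with `q ≥ 2` and in each proper `χ(G)`-colouring exactly `2` or exactly
  `2 ^ q - 2` colour classes are odd. -/
def SimpleGraph.IsUgly {V : Type*} (G : SimpleGraph V) : Prop :=
  G.Connected ∧ 3 ≤ Nat.card V ∧
    ((∃ k : ℕ, G.chromaticNumber = ((4 * k + 2 : ℕ) : ℕ∞) ∧
        ∀ c : G.Coloring (Fin (4 * k + 2)), ∀ i, Odd (c.colorClass i).ncard) ∨
      (∃ q : ℕ, 2 ≤ q ∧ G.chromaticNumber = ((2 ^ q : ℕ) : ℕ∞) ∧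
        ∀ c : G.Coloring (Fin (2 ^ q)),
          c.numOddClasses = 2 ∨ c.numOddClasses = 2 ^ q - 2))

/-! Labelling one edge by `a` adds `a` at both ends, so the weighted degrees of each component sum
to a double `y + y`. Conversely, on a connected non-bipartite graph every weighting whose total is a
double comes from an edge labelling, and on a bipartite one it suffices that the two sides have
equal sums (`exists_weightedDegree_eq`). The task is therefore to find, on each component, a proper
colouring by group elements that satisfies this condition.

For a non-bipartite component, modulo doubles the total of a colouring is the sum of the colours
with odd classes (`Coloring.sum_eq_sum_oddColors_add`). Colours may be permuted, so only the number
`t` of odd classes matters: the question is whether some `t`-subset of the group has a double as its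
sum. By `exists_card_eq_sum_eq_add_self` the only obstructions in a group of order `s ≥ 3` are `t =
s` with `s ≡ 2 (mod 4)`, and `t = 2` or `t = s - 2` in a group of exponent two. Ugliness says that
every colouring meets an obstruction. A component of smaller chromatic number has a spare colour,
and recolouring then changes `t`, except for the complete graph on `s - 2` vertices
(`exists_coloring_numOddClasses_ne`). Bipartite components are treated directly, with ugliness
mattering only for `s = 2`.

The obstructions are genuine in `ZMod 2 × ZMod (2 * k + 1)` and `Fin q → ZMod 2`. In every
exceptional case `s` is even, so groups of order `s + 1` have odd order, where every element is a
double. -/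

/-! ### Subset sums in finite Abelian groups -/

/-- If `x` is not the double of an element, some homomorphism to `ZMod 2` does not vanish at `x`. -/
lemma exists_zmod_two_hom_ne_zero {A : Type*} [AddCommGroup A] {x : A}
    (hx : ¬ ∃ y, x = y + y) : ∃ ψ : A →+ ZMod 2, ψ x ≠ 0 := by
  let H : AddSubgroup A := (nsmulAddMonoidHom (α := A) 2).range
  -- The quotient by the doubles is a vector space over `ZMod 2`, and linear functionals separate
  -- its points.
  let _ : Module (ZMod 2) (A ⧸ H) := QuotientAddGroup.zmodModule fun y => ⟨y, rfl⟩
  have hne : (QuotientAddGroup.mk' H x : A ⧸ H) ≠ 0 := by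
    intro h
    obtain ⟨y, hy⟩ := (QuotientAddGroup.eq_zero_iff x).1 h
    exact hx ⟨y, by rw [← hy, nsmulAddMonoidHom_apply, two_nsmul]⟩
  obtain ⟨φ, hφ⟩ : ∃ φ : Module.Dual (ZMod 2) (A ⧸ H), φ (QuotientAddGroup.mk' H x) ≠ 0 := by
    by_contra! h
    exact hne ((Module.forall_dual_apply_eq_zero_iff (ZMod 2) _).1 h)
  exact ⟨φ.toAddMonoidHom.comp (QuotientAddGroup.mk' H), hφ⟩

/-- The sum of all elements of a finite Abelian group is a double unless the order of the group is
`2` modulo `4`. -/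
lemma sum_univ_eq_add_self {A : Type*} [AddCommGroup A] [Fintype A]
    (h : Fintype.card A % 4 ≠ 2) : ∃ y : A, ∑ a : A, a = y + y := by
  classical
  by_contra hcon
  obtain ⟨ψ, hψ⟩ := exists_zmod_two_hom_ne_zero hcon
  have hz : ∀ z : ZMod 2, z ≠ 0 → z = 1 := by decide
  have hsum : ψ (∑ a : A, a) = ((Finset.univ.filter fun a => ψ a ≠ 0).card : ZMod 2) := by
    rw [map_sum, Finset.card_filter, Nat.cast_sum]
    refine Finset.sum_congr rfl fun a _ => ?_
    split_ifs with ha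
    · simpa using hz _ ha
    · simpa using ha
  obtain ⟨a₀, ha₀⟩ : ∃ a₀, ψ a₀ ≠ 0 := by
    by_contra! hc
    exact hψ (hc _)
  -- Translation by `a₀` swaps the two fibres of `ψ`, so each has half the elements. That half must
  -- be odd for `ψ` not to vanish at the total.
  have heq : (Finset.univ.filter fun a => ψ a ≠ 0).card =
      (Finset.univ.filter fun a => ¬ ψ a ≠ 0).card := by
    refine Finset.card_bij' (fun a _ => a + a₀) (fun a _ => a - a₀) ?_ ?_ ?_ ?_
    · intro a ha
      have := hz _ (Finset.mem_filter.1 ha).2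
      simp only [Finset.mem_filter, Finset.mem_univ, true_and, map_add, this, hz _ ha₀]
      decide
    · intro a ha
      have := not_not.1 (Finset.mem_filter.1 ha).2
      simp only [Finset.mem_filter, Finset.mem_univ, true_and, map_sub, this, hz _ ha₀]
      decide
    · simp
    · simp
  have htot := Finset.card_filter_add_card_filter_not (s := (Finset.univ : Finset A))
    (fun a => ψ a ≠ 0)
  rw [hsum, Ne, ZMod.natCast_eq_zero_iff] at hψ
  rw [Finset.card_univ] at htot
  omega

/-- In a group which is not of exponent two, sums of proper nonempty subsets of any size can be
doubles. -/
lemma exists_card_eq_sum_eq_add_self_of_add_self_ne_zero {A : Type*} [AddCommGroup A] [Fintype A]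
    [DecidableEq A] {g : A} (hg : g + g ≠ 0) {t : ℕ} (h0 : 0 < t) (ht : t < Fintype.card A) :
    ∃ T : Finset A, T.card = t ∧ ∃ y : A, ∑ a ∈ T, a = y + y := by
  by_contra! hcon
  have hswap : ∀ (T : Finset A) (a b : A), a ∈ T → b ∉ T →
      (insert b (T.erase a)).card = T.card ∧
        ∑ x ∈ insert b (T.erase a), x = ∑ x ∈ T, x + (b - a) := by
    intro T a b ha hb
    have hb' : b ∉ T.erase a := fun h => hb (Finset.mem_of_mem_erase h)
    constructor
    · rw [Finset.card_insert_of_notMem hb', Finset.card_erase_add_one ha]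
    · rw [Finset.sum_insert hb', ← Finset.add_sum_erase T _ ha]
      abel
  -- Exchanging `a ∈ T` for `a - ∑ T + 2h` turns the sum into the double `2h`, so that element must
  -- already lie in `T`. Two such moves, with `h = 0` and then `h = g + ∑ T`, amount to translation
  -- by `2g`.
  have hclosed : ∀ T : Finset A, T.card = t → ∀ a ∈ T, a + (g + g) ∈ T := by
    intro T hT
    have key : ∀ a ∈ T, ∀ h : A, a - ∑ x ∈ T, x + (h + h) ∈ T := by
      intro a ha h
      by_contra hb
      obtain ⟨h1, h2⟩ := hswap T a _ ha hb
      exact hcon _ (h1.trans hT) h (by rw [h2]; abel)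
    intro a ha
    have h1 := key a ha 0
    have h2 := key _ h1 (g + ∑ x ∈ T, x)
    convert h2 using 1
    abel
  obtain ⟨T, -, hT⟩ := Finset.exists_subset_card_eq
    (s := (Finset.univ : Finset A)) (n := t) (by rw [Finset.card_univ]; exact ht.le)
  obtain ⟨a, ha⟩ : T.Nonempty := Finset.card_pos.1 (by omega)
  obtain ⟨b, -, hb⟩ := Finset.exists_mem_notMem_of_card_lt_card
    (s := T) (t := Finset.univ) (by rw [Finset.card_univ]; omega)
  have hcl := hclosed _ ((hswap T a b ha hb).1.trans hT)
  have hmem : a + (g + g) ∈ insert b (T.erase a) := by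
    refine Finset.mem_insert_of_mem (Finset.mem_erase.2 ⟨?_, hclosed T hT a ha⟩)
    simpa using hg
  -- The set obtained from `T` by exchanging `a` for `b` is closed under translation by `2g` and
  -- contains `a + 2g`. Going round the cyclic orbit puts the removed `a` back into it, a
  -- contradiction.
  have hiter : ∀ n : ℕ, a + (g + g) + n • (g + g) ∈ insert b (T.erase a) := by
    intro n
    induction n with
    | zero => simpa using hmem
    | succ n ih => rw [succ_nsmul, ← add_assoc]; exact hcl _ ih
  have hlast := hiter (Fintype.card A - 1)
  rw [add_assoc, ← succ_nsmul', Nat.sub_add_cancel (by omega), card_nsmul_eq_zero, add_zero,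
    Finset.mem_insert] at hlast
  rcases hlast with rfl | hlast
  · exact hb ha
  · simp at hlast

/-- In an elementary Abelian `2`-group, zero is the sum of `t` distinct elements for
`3 ≤ t ≤ |A| / 2 + 1`. -/
lemma exists_card_eq_sum_eq_zero_of_le_half {A : Type*} [AddCommGroup A] [Fintype A]
    [DecidableEq A] (h2 : ∀ a : A, a + a = 0) {t : ℕ} (h3 : 3 ≤ t)
    (ht : 2 * t ≤ Fintype.card A + 2) :
    ∃ T : Finset A, T.card = t ∧ ∑ a ∈ T, a = 0 := by
  obtain ⟨T₁, -, hT₁⟩ := Finset.exists_subset_card_eq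
    (s := (Finset.univ : Finset A)) (n := t - 3) (by rw [Finset.card_univ]; omega)
  -- Choosing `e` different from the sum of `T₁` gives `t - 2` elements with nonzero sum `y`. A pair
  -- `a`, `a + y` outside `T₀` then cancels `y`; such a pair exists because `2 * (t - 2) < |A|`.
  obtain ⟨e, -, he⟩ := Finset.exists_mem_notMem_of_card_lt_card
    (s := insert (∑ x ∈ T₁, x) T₁) (t := Finset.univ)
    (by rw [Finset.card_univ]; have := Finset.card_insert_le (∑ x ∈ T₁, x) T₁; omega)
  rw [Finset.mem_insert, not_or] at he
  set T₀ := insert e T₁ with hT₀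
  have hc₀ : T₀.card = t - 2 := by rw [hT₀, Finset.card_insert_of_notMem he.2]; omega
  have hy : ∑ x ∈ T₀, x ≠ 0 := by
    rw [hT₀, Finset.sum_insert he.2]
    intro h
    exact he.1 (by rw [eq_neg_of_add_eq_zero_left h]; exact neg_eq_of_add_eq_zero_left (h2 _))
  set y := ∑ x ∈ T₀, x
  obtain ⟨a, -, ha⟩ := Finset.exists_mem_notMem_of_card_lt_card
    (s := T₀ ∪ T₀.image (· + y)) (t := Finset.univ) (by
      rw [Finset.card_univ]
      have h1 := Finset.card_union_le T₀ (T₀.image (· + y))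
      have h2 := Finset.card_image_le (s := T₀) (f := (· + y))
      omega)
  rw [Finset.mem_union, not_or] at ha
  have hay : a + y ∉ T₀ := fun h => ha.2 (Finset.mem_image.2 ⟨_, h, by
    rw [add_assoc, h2, add_zero]⟩)
  have hne : a ∉ insert (a + y) T₀ := by
    rw [Finset.mem_insert, not_or]
    exact ⟨by simpa using hy, ha.1⟩
  refine ⟨insert a (insert (a + y) T₀), ?_, ?_⟩
  · rw [Finset.card_insert_of_notMem hne, Finset.card_insert_of_notMem hay]
    omega
  · rw [Finset.sum_insert hne, Finset.sum_insert hay]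
    change a + (a + y + y) = 0
    rw [add_assoc a y y, h2 y, add_zero, h2]

/-- Sizes of subsets of a finite Abelian group whose sum is a double. -/
lemma exists_card_eq_sum_eq_add_self {A : Type*} [AddCommGroup A] [Fintype A]
    {t : ℕ} (ht : t ≤ Fintype.card A) (h4 : Fintype.card A % 4 = 2 → t ≠ Fintype.card A)
    (hel : (∀ a : A, a + a = 0) →
      Fintype.card A % 4 ≠ 2 ∧ t ≠ 2 ∧ t + 2 ≠ Fintype.card A) :
    ∃ T : Finset A, T.card = t ∧ ∃ y : A, ∑ a ∈ T, a = y + y := by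
  classical
  rcases Nat.eq_zero_or_pos t with rfl | h0
  · exact ⟨∅, by simp, 0, by simp⟩
  rcases ht.eq_or_lt with rfl | hlt
  · exact ⟨Finset.univ, rfl, sum_univ_eq_add_self fun h => h4 h rfl⟩
  by_cases h2 : ∀ a : A, a + a = 0
  swap
  · push Not at h2
    obtain ⟨g, hg⟩ := h2
    exact exists_card_eq_sum_eq_add_self_of_add_self_ne_zero hg h0 hlt
  obtain ⟨hs, ht2, hts⟩ := hel h2
  have htot : ∑ a : A, a = 0 := by
    obtain ⟨y, hy⟩ := sum_univ_eq_add_self hs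
    rw [hy, h2]
  have hcompl : ∀ T : Finset A, ∑ a ∈ T, a = 0 → ∑ a ∈ Tᶜ, a = 0 := by
    intro T hT
    rw [← htot, ← Finset.sum_add_sum_compl T, hT, zero_add]
  suffices h : ∃ T : Finset A, T.card = t ∧ ∑ a ∈ T, a = 0 by
    obtain ⟨T, hT, hsum⟩ := h
    exact ⟨T, hT, 0, by simpa using hsum⟩
  by_cases h1 : t = 1
  · exact ⟨{0}, by simp [h1], by simp⟩
  by_cases h1' : t + 1 = Fintype.card A
  · refine ⟨({0} : Finset A)ᶜ, ?_, hcompl _ (by simp)⟩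
    rw [Finset.card_compl, Finset.card_singleton]
    omega
  by_cases hhalf : 2 * t ≤ Fintype.card A + 2
  · exact exists_card_eq_sum_eq_zero_of_le_half h2 (by omega) hhalf
  -- The total of the group is zero, so complements of zero-sum sets are zero-sum sets.
  · obtain ⟨T, hT, hsum⟩ := exists_card_eq_sum_eq_zero_of_le_half h2
      (t := Fintype.card A - t) (by omega) (by omega)
    exact ⟨Tᶜ, by rw [Finset.card_compl, hT]; omega, hcompl T hsum⟩

/-- The order of a finite group of exponent two is a power of two. -/
lemma exists_card_eq_two_pow {A : Type*} [AddCommGroup A] [Finite A]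
    (h2 : ∀ a : A, a + a = 0) : ∃ q : ℕ, Nat.card A = 2 ^ q := by
  let _ : Module (ZMod 2) A := AddCommGroup.zmodModule fun a => by rw [two_nsmul, h2]
  exact ⟨_, by rw [Module.natCard_eq_pow_finrank (K := ZMod 2), Nat.card_zmod]⟩

/-- In a group with at least three elements, any prescribed value is a sum of two nonzero
elements. -/
lemma exists_ne_zero_add_eq {A : Type*} [AddCommGroup A] [Finite A]
    (h3 : 3 ≤ Nat.card A) (z : A) : ∃ x y : A, x ≠ 0 ∧ y ≠ 0 ∧ x + y = z := by
  classical
  have := Fintype.ofFinite A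
  obtain ⟨x, -, hx⟩ := Finset.exists_mem_notMem_of_card_lt_card
    (s := {0, z}) (t := (Finset.univ : Finset A)) (by
      rw [Finset.card_univ, ← Nat.card_eq_fintype_card]
      have := Finset.card_le_two (a := (0 : A)) (b := z)
      omega)
  simp only [Finset.mem_insert, Finset.mem_singleton, not_or] at hx
  exact ⟨x, z - x, hx.1, sub_ne_zero.2 (Ne.symm hx.2), by abel⟩

/-- Any finite set with at least two elements carries nowhere zero weights with sum zero. -/
lemma exists_nowhere_zero_sum_eq_zero {W A : Type*} [AddCommGroup A] [Finite A]
    (h3 : 3 ≤ Nat.card A) {S : Finset W} (hS : 2 ≤ S.card) :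
    ∃ g : W → A, (∀ v, g v ≠ 0) ∧ ∑ v ∈ S, g v = 0 := by
  classical
  obtain ⟨u, hu, v, hv, huv⟩ := Finset.one_lt_card.1 hS
  obtain ⟨a, -, ha, -⟩ := exists_ne_zero_add_eq h3 (0 : A)
  obtain ⟨x, y, hx, hy, hxy⟩ := exists_ne_zero_add_eq h3 (-(((S.erase u).erase v).card • a) : A)
  refine ⟨fun w => if w = u then x else if w = v then y else a, fun w => ?_, ?_⟩
  · simp only
    split_ifs <;> assumption
  have hv' : v ∈ S.erase u := Finset.mem_erase.2 ⟨huv.symm, hv⟩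
  rw [← Finset.add_sum_erase S _ hu, ← Finset.add_sum_erase _ _ hv']
  have hrest : ∑ w ∈ (S.erase u).erase v, (if w = u then x else if w = v then y else a) =
      ((S.erase u).erase v).card • a := by
    rw [← Finset.sum_const]
    refine Finset.sum_congr rfl fun w hw => ?_
    simp only [Finset.mem_erase] at hw
    rw [if_neg hw.2.1, if_neg hw.1]
  rw [hrest]
  simp only [if_true, if_neg huv.symm]
  rw [← add_assoc, hxy, neg_add_cancel]

/-! ### Vertex weightings realised by edge labellings -/

namespace SimpleGraph

/-- The condition characterising the vertex weightings of a connected graph that arise from edge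
labellings. -/
def IsBalanced {W A : Type*} [Fintype W] [AddCommGroup A] (H : SimpleGraph W) (w : W → A) : Prop :=
  (¬ H.Colorable 2 ∧ ∃ y, ∑ v, w v = y + y) ∨
    ∃ c : H.Coloring Bool, ∑ v with c v = true, w v = ∑ v with c v = false, w v

/-- Induction along edges in a connected graph. -/
lemma Connected.induction_adj {W : Type*} {H : SimpleGraph W} (hH : H.Connected) {p : W → Prop}
    (r : W) (hr : p r) (hadj : ∀ u v, H.Adj u v → p u → p v) (v : W) : p v := by
  obtain ⟨q⟩ := hH.preconnected r v
  induction q with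
  | nil => exact hr
  | cons h _ ih => exact ih (hadj _ _ h hr)

/-- If the elements `e u a` and `e v a` are opposite for adjacent `u`, `v`, then balanced weightings
are sent to zero. -/
lemma IsBalanced.sum_eq_zero {W A M : Type*} [Fintype W] [AddCommGroup A] [AddCommGroup M]
    {H : SimpleGraph W} (hH : H.Connected) {w : W → A} (hw : H.IsBalanced w)
    (e : W → A →+ M) (he : ∀ u v, H.Adj u v → ∀ a, e u a + e v a = 0) :
    ∑ v, e v (w v) = 0 := by
  classical
  obtain ⟨r⟩ := hH.nonempty
  rcases hw with ⟨hcol, y, hy⟩ | ⟨c, hc⟩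
  · have hpm : ∀ v, (∀ a, e v a = e r a) ∨ ∀ a, e v a = -e r a := by
      refine hH.induction_adj r (Or.inl fun _ => rfl) fun u v huv hu => ?_
      rcases hu with hu | hu
      · right
        intro a
        rw [← hu a]
        exact eq_neg_of_add_eq_zero_right (he u v huv a)
      · left
        intro a
        rw [eq_neg_of_add_eq_zero_right (he u v huv a), hu, neg_neg]
    -- Otherwise the sign in `e v = ± e r` would be a proper 2-colouring. Hence `e r` equals its
    -- negative and kills doubles.
    have hself : ∀ a, e r a = -e r a := by
      by_contra hcon
      refine hcol (Coloring.mk (fun v => decide (∀ a, e v a = e r a)) ?_ :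
        H.Coloring Bool).colorable
      intro u v huv huv'
      rw [decide_eq_decide] at huv'
      by_cases hu : ∀ a, e u a = e r a
      · have hv := huv'.1 hu
        exact hcon fun a => by
          rw [← hu a, ← eq_neg_of_add_eq_zero_right (he u v huv a), hu, hv]
      · have hu' := (hpm u).resolve_left hu
        have hv' := (hpm v).resolve_left fun h => hu (huv'.2 h)
        refine hcon fun a => ?_
        have := eq_neg_of_add_eq_zero_right (he u v huv a)
        rw [hu', hv', neg_neg] at this
        exact this.symm
    have hall : ∀ v a, e v a = e r a := by
      intro v a
      rcases hpm v with h | h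
      · exact h a
      · rw [h a, ← hself a]
    simp_rw [hall, ← map_sum, hy, map_add]
    nth_rw 1 [hself]
    exact neg_add_cancel _
  · have hpm : ∀ v a, e v a = if c v = c r then e r a else -e r a := by
      refine hH.induction_adj r (by simp) fun u v huv hu a => ?_
      rw [eq_neg_of_add_eq_zero_right (he u v huv a), hu a]
      have hne := c.valid huv
      cases hcu : c u <;> cases hcv : c v <;> cases hcr : c r <;> simp_all
    have hsplit : ∀ b, ∑ v with c v = b, e v (w v) =
        if b = c r then e r (∑ v with c v = b, w v) else -e r (∑ v with c v = b, w v) := by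
      intro b
      have : ∀ v ∈ Finset.univ.filter (fun v => c v = b), e v (w v) =
          if b = c r then e r (w v) else -e r (w v) := by
        intro v hv
        rw [hpm, (Finset.mem_filter.1 hv).2]
      rw [Finset.sum_congr rfl this]
      split_ifs
      · rw [map_sum]
      · rw [map_sum, Finset.sum_neg_distrib]
    have hfib := Finset.sum_fiberwise Finset.univ (fun v => c v) (fun v => e v (w v))
    rw [← hfib, Fintype.sum_bool, hsplit, hsplit, hc]
    cases c r <;> simp

variable {V A : Type*} [Fintype V] [AddCommGroup A] (G : SimpleGraph V)

/-- The weighted degree as a homomorphism. -/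
noncomputable def weightedDegreeHom : (G.edgeSet → A) →+ (V → A) where
  toFun f := G.weightedDegree f
  map_zero' := by ext; simp [weightedDegree]
  map_add' f g := by ext; simp [weightedDegree, Finset.sum_add_distrib]

/-- Labelling the single edge `uv` by `a` does it. Modulo realisable weightings, a weight can thus
be moved along an edge at the cost of a sign. -/
lemma single_add_single_mem_range [DecidableEq V] {u v : V} (h : G.Adj u v) (a : A) :
    Pi.single u a + Pi.single v a ∈ (G.weightedDegreeHom (A := A)).range := by
  classical
  refine ⟨Pi.single (⟨s(u, v), G.mem_edgeSet.2 h⟩ : G.edgeSet) a, ?_⟩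
  ext x
  change G.weightedDegree (Pi.single (⟨s(u, v), G.mem_edgeSet.2 h⟩ : G.edgeSet) a) x = _
  rw [weightedDegree, Finset.sum_filter,
    Fintype.sum_eq_single (⟨s(u, v), G.mem_edgeSet.2 h⟩ : G.edgeSet)
      fun e he => by rw [Pi.single_eq_of_ne he, ite_self], Pi.single_eq_same,
    Pi.add_apply, Pi.single_apply, Pi.single_apply]
  have := h.ne
  by_cases hu : x = u <;> by_cases hv : x = v <;> simp_all

/-- A vertex weighting that is balanced on each component comes from an edge labelling. -/
theorem exists_weightedDegree_eq [∀ C : G.ConnectedComponent, Fintype C] (w : V → A)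
    (hw : ∀ C : G.ConnectedComponent, C.toSimpleGraph.IsBalanced fun v : C => w v) :
    ∃ f : G.edgeSet → A, G.weightedDegree f = w := by
  classical
  suffices h : w ∈ (G.weightedDegreeHom (A := A)).range from h
  set R := (G.weightedDegreeHom (A := A)).range
  rw [← QuotientAddGroup.eq_zero_iff]
  -- `e v a` is the class of the weighting that is `a` at `v` and zero elsewhere; realisability of
  -- `w` becomes the vanishing of `∑ v, e v (w v)`.
  let e : V → A →+ ((V → A) ⧸ R) := fun v =>
    (QuotientAddGroup.mk' R).comp (AddMonoidHom.single (fun _ : V => A) v)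
  have hwe : (QuotientAddGroup.mk w : (V → A) ⧸ R) = ∑ v, e v (w v) := by
    conv_lhs => rw [← Finset.univ_sum_single w]
    exact map_sum (QuotientAddGroup.mk' R) _ _
  have hadj : ∀ u v, G.Adj u v → ∀ a, e u a + e v a = 0 := by
    intro u v huv a
    exact (QuotientAddGroup.eq_zero_iff _).2 (G.single_add_single_mem_range huv a)
  rw [hwe, ← Finset.sum_fiberwise Finset.univ G.connectedComponentMk]
  refine Finset.sum_eq_zero fun C _ => ?_
  rw [Finset.sum_subtype (p := fun v => v ∈ C.supp) _ (fun v => by simp)]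
  exact (hw C).sum_eq_zero C.connected_toSimpleGraph (fun v : C => e v)
    fun u v huv a => hadj u v (C.toSimpleGraph_hom.map_adj huv) a

/-- The weighted degrees of the vertices of a component add up to a double. -/
theorem sum_component_weightedDegree (C : G.ConnectedComponent) [Fintype C] (f : G.edgeSet → A) :
    ∃ y : A, ∑ v : C, G.weightedDegree f v = y + y := by
  classical
  have h1 : ∑ v : C, G.weightedDegree f v =
      ∑ e : G.edgeSet, ∑ v ∈ (Finset.univ : Finset C).filter fun v : C => (v : V) ∈ e.1, f e := by
    simp only [weightedDegree, Finset.sum_filter]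
    exact Finset.sum_comm
  -- Each edge has both ends or neither in `C`, so it contributes twice its label or nothing.
  suffices h : ∀ e : G.edgeSet, ∃ y, ∑ v ∈ (Finset.univ : Finset C).filter fun v : C => (v : V) ∈ e.1,
      f e = y + y by
    choose y hy using h
    exact ⟨∑ e, y e, by
      rw [h1, ← Finset.sum_add_distrib]
      exact Finset.sum_congr rfl fun e _ => hy e⟩
  rintro ⟨e, he⟩
  induction e with | _ a b =>
  have hab : G.Adj a b := he
  by_cases ha : a ∈ C
  · have hb : b ∈ C := C.mem_supp_of_adj_mem_supp ha hab
    refine ⟨f ⟨s(a, b), he⟩, ?_⟩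
    have : (Finset.univ.filter fun v : C => (v : V) ∈ s(a, b)) = {⟨a, ha⟩, ⟨b, hb⟩} := by
      ext v
      simp [Subtype.ext_iff]
    rw [this, Finset.sum_pair]
    simpa [Subtype.ext_iff] using hab.ne
  · refine ⟨0, ?_⟩
    have hb : b ∉ C := fun hb => ha (C.mem_supp_of_adj_mem_supp hb hab.symm)
    have : ((Finset.univ : Finset C).filter fun v : C => (v : V) ∈ s(a, b)) = ∅ := by
      refine Finset.filter_false_of_mem fun v _ hv => ?_
      rcases Sym2.mem_iff.1 hv with h | h
      · exact ha (h ▸ v.2)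
      · exact hb (h ▸ v.2)
    rw [this, Finset.sum_empty, add_zero]

end SimpleGraph

/-! ### Recolouring and the parity of colour classes -/

namespace SimpleGraph

variable {W : Type*} {H : SimpleGraph W}

/-- The colours whose colour class has odd size. -/
def Coloring.oddColors {α : Type*} (c : H.Coloring α) : Set α :=
  {i | Odd (c.colorClass i).ncard}

/-- Recolouring one vertex changes the parity of two colour classes. -/
lemma Coloring.exists_recolor [Finite W] {α : Type*} (c : H.Coloring α) {v : W} {j : α}
    (hj : j ≠ c v) (hfree : ∀ u, c u = j → ¬ H.Adj v u) :
    ∃ c' : H.Coloring α, c' v = j ∧ (∀ u, u ≠ v → c' u = c u) ∧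
      ∀ i, i ∈ c'.oddColors ↔ ((i ∈ c.oddColors) ↔ ¬ (i = c v ∨ i = j)) := by
  classical
  let c' : H.Coloring α := Coloring.mk (Function.update c v j) (by
    intro a b hab
    by_cases ha : a = v
    · subst ha
      rw [Function.update_self, Function.update_of_ne hab.ne']
      exact fun h => hfree b h.symm hab
    · by_cases hb : b = v
      · subst hb
        rw [Function.update_self, Function.update_of_ne ha]
        exact fun h => hfree a h hab.symm
      · rw [Function.update_of_ne ha, Function.update_of_ne hb]
        exact c.valid hab)
  have hv : c' v = j := by
    change Function.update (c : W → α) v j v = j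
    rw [Function.update_self]
  have hu : ∀ u, u ≠ v → c' u = c u := by
    intro u hu
    change Function.update (c : W → α) v j u = c u
    rw [Function.update_of_ne hu]
  refine ⟨c', hv, hu, fun i => ?_⟩
  change Odd (c'.colorClass i).ncard ↔ (Odd (c.colorClass i).ncard ↔ _)
  by_cases hij : i = j
  · subst hij
    have : c'.colorClass i = insert v (c.colorClass i) := by
      ext u
      by_cases h : u = v
      · subst h; simp [Coloring.colorClass, hv]
      · simp [Coloring.colorClass, hu u h, h]
    rw [this, Set.ncard_insert_of_notMem (show v ∉ c.colorClass i from fun h => hj (Eq.symm h))]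
    simp [Nat.odd_add_one]
  · by_cases hic : i = c v
    · have : insert v (c'.colorClass i) = c.colorClass i := by
        ext u
        by_cases h : u = v
        · subst h; simp [Coloring.colorClass, hic]
        · simp [Coloring.colorClass, hu u h, h]
      rw [← this, Set.ncard_insert_of_notMem
        (show v ∉ c'.colorClass i from fun h => hij (Eq.trans (Eq.symm h) hv))]
      simp [Nat.odd_add_one, hic]
    · have : c'.colorClass i = c.colorClass i := by
        ext u
        by_cases h : u = v
        · subst h; simp [Coloring.colorClass, hv, Ne.symm hij, Ne.symm hic]
        · simp [Coloring.colorClass, hu u h]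
      rw [this]
      simp [hij, hic]

lemma Coloring.not_odd_of_forall_ne {α : Type*} (c : H.Coloring α) {j : α} (hj : ∀ v, c v ≠ j) :
    ¬ Odd (c.colorClass j).ncard := by
  rw [show c.colorClass j = ∅ from Set.eq_empty_of_forall_notMem hj]
  simp

/-- Moving a vertex from a nonempty even colour class to an empty one. -/
lemma Coloring.exists_numOddClasses_add_two [Finite W] {α : Type*} [Finite α] (c : H.Coloring α)
    {v : W} {j : α} (hv : c v ∉ c.oddColors) (hj : ∀ u, c u ≠ j) :
    ∃ c' : H.Coloring α, c'.numOddClasses = c.numOddClasses + 2 := by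
  obtain ⟨c', -, -, hc'⟩ := c.exists_recolor (v := v) (hj v).symm fun u hu => absurd hu (hj u)
  have hj' : j ∉ c.oddColors := c.not_odd_of_forall_ne hj
  refine ⟨c', ?_⟩
  have : c'.oddColors = insert j (insert (c v) c.oddColors) := by
    ext i
    rw [hc', Set.mem_insert_iff, Set.mem_insert_iff]
    by_cases h1 : i = j
    · simp [h1, hj']
    · by_cases h2 : i = c v
      · simp [h2, hv]
      · simp [h1, h2]
  change c'.oddColors.ncard = _
  rw [this, Set.ncard_insert_of_notMem _ (Set.toFinite _), Set.ncard_insert_of_notMem hv]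
  · rfl
  · rw [Set.mem_insert_iff, not_or]
    exact ⟨(hj v).symm, hj'⟩

/-- Moving a vertex between two odd colour classes. -/
lemma Coloring.exists_numOddClasses_eq_add_two [Finite W] {α : Type*} [Finite α]
    (c : H.Coloring α) {v : W} {j : α} (hjv : j ≠ c v) (hv : c v ∈ c.oddColors)
    (hj : j ∈ c.oddColors) (hfree : ∀ u, c u = j → ¬ H.Adj v u) :
    ∃ c' : H.Coloring α, c.numOddClasses = c'.numOddClasses + 2 := by
  obtain ⟨c', -, -, hc'⟩ := c.exists_recolor hjv hfree
  refine ⟨c', ?_⟩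
  have : c.oddColors = insert j (insert (c v) c'.oddColors) := by
    ext i
    rw [Set.mem_insert_iff, Set.mem_insert_iff, hc']
    by_cases h1 : i = j
    · simp [h1, hj]
    · by_cases h2 : i = c v
      · simp [h2, hv]
      · simp [h1, h2]
  change c.oddColors.ncard = _
  rw [this, Set.ncard_insert_of_notMem _ (Set.toFinite _), Set.ncard_insert_of_notMem]
  · rfl
  · simp [hc', hv]
  · rw [Set.mem_insert_iff, not_or]
    exact ⟨hjv, by simp [hc', hj]⟩

/-- Moving a vertex from an odd colour class to an empty one keeps the number of odd classes. -/
lemma Coloring.exists_numOddClasses_eq [Finite W] {α : Type*} [Finite α] (c : H.Coloring α)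
    {v : W} {j : α} (hv : c v ∈ c.oddColors) (hj : ∀ u, c u ≠ j) :
    ∃ c' : H.Coloring α, c' v = j ∧ (∀ u, u ≠ v → c' u = c u) ∧ c v ∉ c'.oddColors ∧
      c'.numOddClasses = c.numOddClasses := by
  obtain ⟨c', h1, h2, hc'⟩ := c.exists_recolor (v := v) (hj v).symm fun u hu => absurd hu (hj u)
  have hj' : j ∉ c.oddColors := c.not_odd_of_forall_ne hj
  refine ⟨c', h1, h2, by simp [hc', hv], ?_⟩
  have : c'.oddColors = insert j (c.oddColors \ {c v}) := by
    ext i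
    rw [hc', Set.mem_insert_iff, Set.mem_sdiff, Set.mem_singleton_iff]
    by_cases h1 : i = j
    · simp [h1, hj']
    · by_cases h2 : i = c v
      · simp [h2, hv, (hj v)]
      · simp [h1, h2]
  change c'.oddColors.ncard = c.oddColors.ncard
  rw [this, Set.ncard_insert_of_notMem (fun h => hj' h.1), Set.ncard_sdiff_singleton_add_one hv]

lemma Coloring.colorable_of_range_subset {α : Type*} (c : H.Coloring α) {S : Set α}
    (hS : S.Finite) (h : ∀ v, c v ∈ S) : H.Colorable S.ncard := by
  have := hS.fintype
  let c' : H.Coloring S := Coloring.mk (fun v => ⟨c v, h v⟩) fun hab heq =>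
    c.valid hab (congrArg Subtype.val heq)
  rw [Set.ncard_eq_toFinset_card' S, Set.toFinset_card]
  exact c'.colorable

lemma Colorable.exists_coloring_forall_ne {s : ℕ} (hs : 0 < s) (hcol : H.Colorable (s - 1)) :
    ∃ (c : H.Coloring (Fin s)) (j : Fin s), ∀ v, c v ≠ j := by
  obtain ⟨n, rfl⟩ : ∃ n, s = n + 1 := ⟨s - 1, by omega⟩
  obtain ⟨c⟩ := hcol
  exact ⟨Coloring.mk (fun v => Fin.castSucc (c v))
    fun hab h => c.valid hab (Fin.castSucc_injective _ h), Fin.last n,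
    fun v => (Fin.castSucc_lt_last _).ne⟩

/-- A non-bipartite graph with an `s`-colouring that does not use all colours has a colouring in
which the number of odd classes is neither `2` nor `s - 2`, unless it is `K_{s-2}`. -/
lemma exists_coloring_numOddClasses_ne [Finite W] (h2 : ¬ H.Colorable 2) {s : ℕ}
    (hs4 : 4 ≤ s) (hs6 : s ≠ 6) (hcol : H.Colorable (s - 1))
    (hK : ¬ Nonempty (H ≃g completeGraph (Fin (s - 2)))) :
    ∃ c : H.Coloring (Fin s), c.numOddClasses ≠ 2 ∧ c.numOddClasses + 2 ≠ s := by
  classical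
  have := Fintype.ofFinite W
  obtain ⟨c, j, hj⟩ := hcol.exists_coloring_forall_ne (by omega)
  by_cases hgood : c.numOddClasses ≠ 2 ∧ c.numOddClasses + 2 ≠ s
  · exact ⟨c, hgood⟩
  have ht : c.numOddClasses = 2 ∨ c.numOddClasses + 2 = s := by tauto
  -- With a nonempty even class the count rises by two, from `2` to `4` or from `s - 2` to `s`; `4 =
  -- s - 2` is excluded by `s ≠ 6`.
  by_cases hev : ∃ v, c v ∉ c.oddColors
  · obtain ⟨v, hv⟩ := hev
    obtain ⟨c', hc'⟩ := c.exists_numOddClasses_add_two hv hj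
    exact ⟨c', by omega, by omega⟩
  push Not at hev
  have hcodd := c.colorable_of_range_subset (Set.toFinite _) hev
  -- All used colours are now odd, so only two odd classes would make the graph 2-colourable. Hence
  -- exactly `s - 2` colours are used and two are free.
  have ht2 : c.numOddClasses ≠ 2 := fun h => h2 (h ▸ hcodd)
  have hts := ht.resolve_left ht2
  by_cases hinj : Function.Injective c
  · have hrange : c.oddColors = Set.range c := by
      refine Set.Subset.antisymm (fun i hi => ?_) (Set.range_subset_iff.2 hev)
      obtain ⟨v, hv⟩ := Set.nonempty_of_ncard_ne_zero (Nat.odd_iff.1 hi |> fun h => by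
        intro h0; rw [h0] at h; simp at h)
      exact ⟨v, hv⟩
    have hcard : Fintype.card W = s - 2 := by
      have : c.oddColors.ncard + 2 = s := hts
      rw [hrange, ← Set.image_univ, Set.ncard_image_of_injective _ hinj, Set.ncard_univ,
        Nat.card_eq_fintype_card] at this
      omega
    -- All classes are singletons. Merging a non-adjacent pair leaves `s - 4` odd classes; without
    -- such a pair the graph is the excluded complete graph.
    by_cases htop : ∃ u v, u ≠ v ∧ ¬ H.Adj u v
    · obtain ⟨u, v, huv, hadj⟩ := htop
      obtain ⟨c', hc'⟩ := c.exists_numOddClasses_eq_add_two (v := u) (j := c v)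
        (fun h => huv (hinj h.symm)) (hev u) (hev v) fun x hx => by rwa [hinj hx]
      exact ⟨c', by omega, by omega⟩
    · push Not at htop
      refine absurd ⟨⟨Fintype.equivFinOfCardEq hcard, ?_⟩⟩ hK
      intro a b
      simp only [completeGraph, top_adj, ne_eq, EmbeddingLike.apply_eq_iff_eq]
      exact ⟨htop a b, fun h => h.ne⟩
  · obtain ⟨u, v, huv, hne⟩ := Function.not_injective_iff.1 hinj
    -- Moving `u` and then `v` from their common class to the two free colours makes all `s` classes
    -- odd.
    obtain ⟨j', hj'⟩ : ∃ j', j' ≠ j ∧ ∀ v, c v ≠ j' := by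
      have hlt : (insert j c.oddColors).ncard < (Set.univ : Set (Fin s)).ncard := by
        have h1 := Set.ncard_insert_le j c.oddColors
        have h2 : c.oddColors.ncard + 2 = s := hts
        rw [Set.ncard_univ, Nat.card_fin]
        omega
      obtain ⟨j', -, hj'⟩ := Set.exists_mem_notMem_of_ncard_lt_ncard hlt
      rw [Set.mem_insert_iff, not_or] at hj'
      exact ⟨j', hj'.1, fun v hv => hj'.2 (hv ▸ hev v)⟩
    obtain ⟨c', hc'u, hc', hodd, hnum⟩ := c.exists_numOddClasses_eq (hev u) hj
    have hc'v : c' v = c u := by rw [hc' v hne.symm, huv]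
    obtain ⟨c'', hc''⟩ := c'.exists_numOddClasses_add_two (v := v) (j := j') (hc'v ▸ hodd) (by
      intro x
      by_cases hx : x = u
      · rw [hx, hc'u]; exact hj'.1.symm
      · rw [hc' x hx]; exact hj'.2 x)
    exact ⟨c'', by omega, by omega⟩

lemma Coloring.numOddClasses_le {s : ℕ} (c : H.Coloring (Fin s)) : c.numOddClasses ≤ s := by
  have h := Set.ncard_le_card c.oddColors
  rwa [Nat.card_fin] at h

lemma Coloring.numOddClasses_ne {s : ℕ} (c : H.Coloring (Fin s)) {i : Fin s}
    (hi : ¬ Odd (c.colorClass i).ncard) : c.numOddClasses ≠ s := by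
  intro h
  have huniv : c.oddColors = Set.univ := Set.eq_of_subset_of_ncard_le (Set.subset_univ _)
    (by rw [Set.ncard_univ, Nat.card_fin]; exact h.ge)
  exact hi (huniv ▸ Set.mem_univ i : i ∈ c.oddColors)

lemma Coloring.oddColors_of_equiv {α β : Type*} (c : H.Coloring α) (d : H.Coloring β)
    (e : α ≃ β) (h : ∀ v, d v = e (c v)) : d.oddColors = e '' c.oddColors := by
  ext i
  obtain ⟨i, rfl⟩ := e.surjective i
  rw [e.injective.mem_set_image]
  have : d.colorClass (e i) = c.colorClass i := by
    ext v
    change d v = e i ↔ c v = i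
    rw [h, e.apply_eq_iff_eq]
  change Odd _ ↔ Odd _
  rw [this]

lemma Coloring.numOddClasses_of_equiv {α β : Type*} (c : H.Coloring α) (d : H.Coloring β)
    (e : α ≃ β) (h : ∀ v, d v = e (c v)) : d.numOddClasses = c.numOddClasses := by
  change d.oddColors.ncard = c.oddColors.ncard
  rw [c.oddColors_of_equiv d e h, Set.ncard_image_of_injective _ e.injective]

variable {A : Type*} [AddCommGroup A]

/-- Modulo doubles, the sum of a colouring by group elements is the sum of its odd colours. -/
lemma Coloring.sum_eq_sum_oddColors_add [Fintype W] [Fintype A] (c : H.Coloring A) {O : Finset A}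
    (hO : (O : Set A) = c.oddColors) : ∃ z : A, ∑ v, c v = ∑ a ∈ O, a + (z + z) := by
  classical
  have hcard : ∀ a, (c.colorClass a).ncard = (Finset.univ.filter fun v => c v = a).card := by
    intro a
    rw [← Set.ncard_coe_finset]
    congr 1
    ext v
    simp [Coloring.colorClass]
  have hdiv : ∀ a : A, ∃ z : A, ∑ v with c v = a, c v = (if a ∈ O then a else 0) + (z + z) := by
    intro a
    rw [Finset.sum_congr rfl (g := fun _ => a) fun v hv => (Finset.mem_filter.1 hv).2,
      Finset.sum_const, ← hcard]
    have hmem : a ∈ O ↔ Odd (c.colorClass a).ncard := by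
      rw [← Finset.mem_coe, hO]
      rfl
    by_cases h : Odd (c.colorClass a).ncard
    · obtain ⟨k, hk⟩ := h
      refine ⟨k • a, ?_⟩
      rw [if_pos (hmem.2 ⟨k, hk⟩), hk, add_nsmul, mul_nsmul', two_nsmul, one_nsmul, add_comm]
    · rw [if_neg fun h' => h (hmem.1 h')]
      obtain ⟨k, hk⟩ := Nat.not_odd_iff_even.1 h
      exact ⟨k • a, by rw [hk, add_nsmul, zero_add]⟩
  choose z hz using hdiv
  refine ⟨∑ a, z a, ?_⟩
  rw [← Finset.sum_fiberwise Finset.univ c c, Finset.sum_congr rfl fun a _ => hz a,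
    Finset.sum_add_distrib, Finset.sum_add_distrib]
  simp

/-- The colours of a colouring can be replaced by group elements so that the odd ones form a given
set. -/
lemma Coloring.exists_coloring_sum_eq [Fintype W] [Fintype A] {s : ℕ} (c : H.Coloring (Fin s))
    (hs : Fintype.card A = s) {T : Finset A} (hT : T.card = c.numOddClasses) :
    ∃ (d : H.Coloring A) (z : A), ∑ v, d v = ∑ a ∈ T, a + (z + z) := by
  classical
  let e₀ : Fin s ≃ A := (Fintype.equivFinOfCardEq hs).symm
  let O : Finset A := (e₀ '' c.oddColors).toFinset
  have hO : O.card = T.card := by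
    rw [hT, ← Set.ncard_eq_toFinset_card', Set.ncard_image_of_injective _ e₀.injective]
    rfl
  -- The bijection from the odd colours onto `T` is extended to a permutation of all colours.
  let π : Equiv.Perm A := (Finset.equivOfCardEq hO).extendSubtype
  have hπ : π '' (e₀ '' c.oddColors) = T := by
    have hsub : O.image π ⊆ T := by
      intro a ha
      obtain ⟨b, hb, rfl⟩ := Finset.mem_image.1 ha
      exact (Finset.equivOfCardEq hO).extendSubtype_mem b hb
    have := Finset.eq_of_subset_of_card_le hsub
      (by rw [Finset.card_image_of_injective _ π.injective, hO])
    rw [← this, Finset.coe_image, Set.coe_toFinset]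
  let d : H.Coloring A := Coloring.mk (fun v => π (e₀ (c v))) fun hab h =>
    c.valid hab (e₀.injective (π.injective h))
  have hd : (T : Set A) = d.oddColors := by
    rw [c.oddColors_of_equiv d (e₀.trans π) fun v => rfl, ← hπ, Set.image_image]
    rfl
  exact ⟨d, d.sum_eq_sum_oddColors_add hd⟩

end SimpleGraph

/-! ### Balanced colourings of connected graphs, and obstructions -/

namespace SimpleGraph

variable {W : Type*} [Fintype W] {H : SimpleGraph W} {A : Type*} [AddCommGroup A]

/-- The link between the subset-sum result and colourings: the odd colours are renamed to a set
whose sum is a double. A group of exponent two has order a power of two, here at least `4`, so it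
never has order `2` modulo `4`. -/
lemma exists_isBalanced_of_numOddClasses [Finite A] (h2 : ¬ H.Colorable 2) {s : ℕ}
    (hs : Nat.card A = s) (c : H.Coloring (Fin s)) (h4 : s % 4 = 2 → c.numOddClasses ≠ s)
    (hel : (∀ a : A, a + a = 0) → c.numOddClasses ≠ 2 ∧ c.numOddClasses + 2 ≠ s) :
    ∃ w : H.Coloring A, H.IsBalanced w := by
  have := Fintype.ofFinite A
  rw [Nat.card_eq_fintype_card] at hs
  have hs3 : 3 ≤ s := by
    by_contra! h
    exact h2 (c.colorable.mono (by rw [Fintype.card_fin]; omega))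
  obtain ⟨T, hT, y, hy⟩ := exists_card_eq_sum_eq_add_self (A := A) (t := c.numOddClasses)
    (by rw [hs]; exact c.numOddClasses_le) (by rwa [hs]) (by
      intro h
      refine ⟨?_, by rw [hs]; exact hel h⟩
      obtain ⟨q, hq⟩ := exists_card_eq_two_pow h
      rw [Nat.card_eq_fintype_card] at hq
      rcases q with _ | _ | q
      · omega
      · omega
      · rw [hq, pow_add]
        omega)
  obtain ⟨w, z, hw⟩ := c.exists_coloring_sum_eq hs hT
  exact ⟨w, Or.inl ⟨h2, y + z, by rw [hw, hy]; abel⟩⟩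

/-- Groups of odd order admit balanced colourings of non-bipartite graphs. -/
lemma exists_isBalanced_of_odd [Finite A] (h2 : ¬ H.Colorable 2) {s : ℕ}
    (hs : Nat.card A = s) (hodd : Odd s) (hcol : H.Colorable s) :
    ∃ w : H.Coloring A, H.IsBalanced w := by
  let e : Fin s ≃ A := (Finite.equivFinOfCardEq hs).symm
  let w : H.Coloring A := Coloring.mk (fun v => e (hcol.some v)) fun hab h =>
    hcol.some.valid hab (e.injective h)
  refine ⟨w, Or.inl ⟨h2, ?_⟩⟩
  obtain ⟨k, hk⟩ := hodd
  -- Multiplication by `k + 1` halves, since `2 * (k + 1) = s + 1` and `s` annihilates the group.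
  refine ⟨(k + 1) • ∑ v, w v, ?_⟩
  have h0 : s • ∑ v, w v = 0 := by rw [← hs]; exact card_nsmul_eq_zero'
  rw [← add_nsmul, show k + 1 + (k + 1) = s + 1 by omega, add_nsmul, h0, zero_add, one_nsmul]

/-- Groups with at least three elements admit balanced colourings of bipartite graphs. -/
lemma exists_isBalanced_of_colorable_two [Finite A] (h2 : H.Colorable 2)
    (hW : 3 ≤ Fintype.card W) (hA : 3 ≤ Nat.card A) :
    ∃ w : H.Coloring A, H.IsBalanced w := by
  classical
  obtain ⟨c⟩ : Nonempty (H.Coloring Bool) := h2.toColoring (by simp) |> fun c => ⟨c⟩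
  obtain ⟨b, hb⟩ : ∃ b, 2 ≤ (Finset.univ.filter fun v => c v = b).card := by
    by_contra! h
    have h1 := h true
    have h2 := h false
    have h3 := Finset.card_eq_sum_card_fiberwise (f := c) (s := Finset.univ) (t := Finset.univ)
      (fun _ _ => Finset.mem_coe.2 (Finset.mem_univ _))
    rw [Fintype.sum_bool, Finset.card_univ] at h3
    omega
  obtain ⟨g, hg0, hg⟩ := exists_nowhere_zero_sum_eq_zero hA hb
  -- One side gets weight zero, and the side with at least two vertices gets nonzero weights of sum
  -- zero. The colouring is then proper and both side sums vanish.
  let w : H.Coloring A := Coloring.mk (fun v => if c v = b then g v else 0) (by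
    intro u v huv h
    have hne := c.valid huv
    by_cases hu : c u = b
    · rw [if_pos hu, if_neg fun hv => hne (hu.trans hv.symm)] at h
      exact hg0 _ h
    · have hv : c v = b := by cases hu' : c u <;> cases hv' : c v <;> cases b <;> simp_all
      rw [if_neg hu, if_pos hv] at h
      exact hg0 _ h.symm)
  refine ⟨w, Or.inr ⟨c, ?_⟩⟩
  have key : ∀ d, ∑ v with c v = d, w v = 0 := by
    intro d
    by_cases hd : d = b
    · subst hd
      rw [← hg]
      exact Finset.sum_congr rfl fun v hv => if_pos (Finset.mem_filter.1 hv).2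
    · exact Finset.sum_eq_zero fun v hv => if_neg fun h => hd ((Finset.mem_filter.1 hv).2 ▸ h)
  rw [key, key]

/-- A bipartite graph with a colour class of even size has a balanced colouring by the group of
order two. -/
lemma exists_isBalanced_of_even_class (hA : Nat.card A = 2) (c : H.Coloring (Fin 2))
    {i : Fin 2} (hi : ¬ Odd (c.colorClass i).ncard) :
    ∃ w : H.Coloring A, H.IsBalanced w := by
  classical
  have : Finite A := Nat.finite_of_card_ne_zero (by omega)
  have : Nontrivial A := Finite.one_lt_card_iff_nontrivial.1 (by omega)
  obtain ⟨a, ha⟩ := exists_ne (0 : A)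
  have ha2 : 2 • a = 0 := by rw [← hA]; exact card_nsmul_eq_zero'
  have hiff : ∀ u v, H.Adj u v → (c u = i ↔ c v ≠ i) := by
    intro u v huv
    have hne := c.valid huv
    omega
  let w : H.Coloring A := Coloring.mk (fun v => if c v = i then a else 0) (by
    intro u v huv h
    have := hiff u v huv
    by_cases hu : c u = i
    · rw [if_pos hu, if_neg (this.1 hu)] at h
      exact ha h
    · rw [if_neg hu, if_pos (by tauto)] at h
      exact ha h.symm)
  let d : H.Coloring Bool := Coloring.mk (fun v => decide (c v = i)) (by
    intro u v huv h
    rw [decide_eq_decide] at h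
    have := hiff u v huv
    tauto)
  refine ⟨w, Or.inr ⟨d, ?_⟩⟩
  have hfalse : ∑ v with d v = false, w v = 0 :=
    Finset.sum_eq_zero fun v hv => if_neg (of_decide_eq_false (Finset.mem_filter.1 hv).2)
  have htrue : ∑ v with d v = true, w v = (c.colorClass i).ncard • a := by
    have hwa : ∀ v ∈ Finset.univ.filter (fun v => d v = true), w v = a := fun v hv =>
      if_pos (of_decide_eq_true (Finset.mem_filter.1 hv).2)
    rw [Finset.sum_congr rfl hwa, Finset.sum_const,
      ← Set.ncard_coe_finset]
    congr 2
    ext v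
    rw [Finset.coe_filter]
    change (v ∈ Finset.univ ∧ decide (c v = i) = true) ↔ c v = i
    simp
  rw [hfalse, htrue]
  obtain ⟨k, hk⟩ := Nat.not_odd_iff_even.1 hi
  rw [hk, ← two_mul, mul_nsmul, ha2, nsmul_zero]

/-- Connected graphs on at least three vertices that are not ugly have balanced colourings by all
groups of order `s`, with one exception. -/
lemma exists_isBalanced [Finite A] (hH : H.Connected) (hW : 3 ≤ Fintype.card W) {s : ℕ}
    (hs : Nat.card A = s) (hcol : H.Colorable s) (hugly : H.chromaticNumber = s → ¬ H.IsUgly)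
    (hK : ∀ q : ℕ, 2 ≤ q → s = 2 ^ q → ¬ Nonempty (H ≃g completeGraph (Fin (2 ^ q - 2)))) :
    ∃ w : H.Coloring A, H.IsBalanced w := by
  -- Smaller chromatic number means a spare colour, which replaces non-ugliness below.
  have hlt : H.chromaticNumber ≠ s → H.Colorable (s - 1) := by
    intro h
    have hlt : H.chromaticNumber < s := lt_of_le_of_ne hcol.chromaticNumber_le h
    rw [← chromaticNumber_le_iff_colorable]
    have hs0 : s ≠ 0 := by rintro rfl; simp at hlt
    obtain ⟨n, rfl⟩ := Nat.exists_eq_succ_of_ne_zero hs0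
    rw [Nat.cast_succ] at hlt
    exact ENat.lt_add_one_iff (ENat.natCast_ne_top n) |>.1 hlt
  have hu : H.chromaticNumber = s →
      (∀ k : ℕ, s = 4 * k + 2 → ∃ c : H.Coloring (Fin s), ∃ i, ¬ Odd (c.colorClass i).ncard) ∧
      ∀ q : ℕ, 2 ≤ q → s = 2 ^ q →
        ∃ c : H.Coloring (Fin s), c.numOddClasses ≠ 2 ∧ c.numOddClasses + 2 ≠ s := by
    intro h
    have hn := hugly h
    rw [IsUgly, Nat.card_eq_fintype_card] at hn
    constructor
    · rintro k rfl
      by_contra! hcon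
      exact hn ⟨hH, hW, Or.inl ⟨k, h, hcon⟩⟩
    · rintro q hq rfl
      by_contra! hcon
      exact hn ⟨hH, hW, Or.inr ⟨q, hq, h, fun c => by have := hcon c; omega⟩⟩
  by_cases h2 : H.Colorable 2
  · rcases Nat.lt_or_ge s 3 with h3 | h3
    · have : Nontrivial W := Fintype.one_lt_card_iff_nontrivial.1 (by omega)
      have hbot : 2 ≤ H.chromaticNumber := by
        obtain ⟨v⟩ := hH.nonempty
        obtain ⟨u, huv⟩ := hH.preconnected.exists_adj_of_nontrivial v
        exact two_le_chromaticNumber_of_adj huv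
      have hle := hcol.chromaticNumber_le
      have hs2 : s = 2 := by
        have : (2 : ℕ∞) ≤ s := hbot.trans hle
        have : 2 ≤ s := by exact_mod_cast this
        omega
      subst hs2
      obtain ⟨c, i, hi⟩ := (hu (le_antisymm hle hbot)).1 0 rfl
      exact exists_isBalanced_of_even_class hs c hi
    · exact exists_isBalanced_of_colorable_two h2 hW (by omega)
  have hs3 : 3 ≤ s := by
    by_contra! h
    exact h2 (hcol.mono (by omega))
  by_cases h4 : s % 4 = 2
  · obtain ⟨c, hc⟩ : ∃ c : H.Coloring (Fin s), c.numOddClasses ≠ s := by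
      by_cases hchi : H.chromaticNumber = s
      · obtain ⟨c, i, hi⟩ := (hu hchi).1 (s / 4) (by omega)
        exact ⟨c, c.numOddClasses_ne hi⟩
      · obtain ⟨c, j, hj⟩ := (hlt hchi).exists_coloring_forall_ne (by omega)
        exact ⟨c, c.numOddClasses_ne (c.not_odd_of_forall_ne hj)⟩
    refine exists_isBalanced_of_numOddClasses h2 hs c (fun _ => hc) fun h => ?_
    obtain ⟨q, hq⟩ := exists_card_eq_two_pow h
    rw [hs] at hq
    rcases q with _ | _ | q
    · omega
    · omega
    · rw [pow_add] at hq
      omega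
  by_cases hel : ∀ a : A, a + a = 0
  · obtain ⟨q, hq⟩ := exists_card_eq_two_pow hel
    rw [hs] at hq
    have hq2 : 2 ≤ q := by
      by_contra! h
      interval_cases q <;> omega
    obtain ⟨c, hc⟩ : ∃ c : H.Coloring (Fin s), c.numOddClasses ≠ 2 ∧ c.numOddClasses + 2 ≠ s := by
      by_cases hchi : H.chromaticNumber = s
      · exact (hu hchi).2 q hq2 hq
      · have h4s : 4 ∣ s := by rw [hq]; exact pow_dvd_pow 2 hq2
        exact exists_coloring_numOddClasses_ne h2 (by omega) (by omega) (hlt hchi)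
          (by have := hK q hq2 hq; rwa [← hq] at this)
    exact exists_isBalanced_of_numOddClasses h2 hs c (fun h => absurd h h4) fun _ => hc
  · exact exists_isBalanced_of_numOddClasses h2 hs hcol.some (fun h => absurd h h4)
      fun h => absurd h hel

/-- If all colour classes of all `(4k+2)`-colourings are odd, then sums of colourings by elements
of `ZMod 2 × ZMod (2k+1)` are not doubles. -/
lemma Coloring.sum_ne_add_self_of_forall_odd {k : ℕ}
    (hodd : ∀ c : H.Coloring (Fin (4 * k + 2)), ∀ i, Odd (c.colorClass i).ncard)
    (w : H.Coloring (ZMod 2 × ZMod (2 * k + 1))) (y : ZMod 2 × ZMod (2 * k + 1)) :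
    ∑ v, w v ≠ y + y := by
  intro hy
  have hcard : Fintype.card (ZMod 2 × ZMod (2 * k + 1)) = 4 * k + 2 := by
    rw [Fintype.card_prod, ZMod.card, ZMod.card]
    ring
  let e := Fintype.equivFinOfCardEq hcard
  let c : H.Coloring (Fin (4 * k + 2)) := Coloring.mk (fun v => e (w v)) fun hab h =>
    w.valid hab (e.injective h)
  obtain ⟨z, hz⟩ := w.sum_eq_sum_oddColors_add (O := Finset.univ) (by
    rw [c.oddColors_of_equiv w e.symm fun v => (e.symm_apply_apply _).symm,
      show c.oddColors = Set.univ from Set.eq_univ_of_forall (hodd c), Set.image_univ,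
      e.symm.range_eq_univ, Finset.coe_univ])
  -- The first coordinate kills doubles, whereas the sum of all group elements has first coordinate
  -- `2 * k + 1`, which is `1` in `ZMod 2`.
  have h1 := congrArg Prod.fst (hy.symm.trans hz)
  have hdbl : ∀ a : ZMod 2, a + a = 0 := by decide
  rw [Prod.fst_add, Prod.fst_add, Prod.fst_add, hdbl, hdbl, add_zero, Prod.fst_sum,
    Fintype.sum_prod_type_right] at h1
  have h2 : ∑ x : ZMod 2, x = 1 := by decide
  simp only [h2, Finset.sum_const, Finset.card_univ, ZMod.card, nsmul_eq_mul, mul_one] at h1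
  push_cast at h1
  rw [show (2 : ZMod 2) = 0 from rfl] at h1
  simp at h1

/-- In `(ZMod 2) ^ q` with `q ≥ 2`, neither two nor all but two elements have sum zero. -/
lemma Coloring.sum_ne_zero_of_numOddClasses {q : ℕ} (hq : 2 ≤ q)
    (w : H.Coloring (Fin q → ZMod 2))
    (hw : w.numOddClasses = 2 ∨ w.numOddClasses = 2 ^ q - 2) : ∑ v, w v ≠ 0 := by
  classical
  have hdbl : ∀ a : Fin q → ZMod 2, a + a = 0 := by
    intro a
    funext i
    exact (by decide : ∀ a : ZMod 2, a + a = 0) (a i)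
  have hcard : Fintype.card (Fin q → ZMod 2) = 2 ^ q := by simp
  have hdvd : 4 ∣ 2 ^ q := pow_dvd_pow 2 hq
  -- In exponent two, `a + b = 0` forces `a = b`. The case of all but two odd colours follows by
  -- complementation, the total being zero.
  have hpair : ∀ T : Finset (Fin q → ZMod 2), T.card = 2 → ∑ a ∈ T, a ≠ 0 := by
    intro T hT h
    obtain ⟨a, b, hab, rfl⟩ := Finset.card_eq_two.1 hT
    rw [Finset.sum_pair hab] at h
    exact hab (add_right_cancel (h.trans (hdbl b).symm))
  have htot : ∑ a : Fin q → ZMod 2, a = 0 := by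
    obtain ⟨y, hy⟩ := sum_univ_eq_add_self (A := Fin q → ZMod 2) (by rw [hcard]; omega)
    rw [hy, hdbl]
  have hO : ((w.oddColors.toFinset : Finset _) : Set (Fin q → ZMod 2)) = w.oddColors :=
    Set.coe_toFinset _
  obtain ⟨z, hz⟩ := w.sum_eq_sum_oddColors_add hO
  have hOc : w.oddColors.toFinset.card = w.numOddClasses := by
    rw [← Set.ncard_eq_toFinset_card']
    rfl
  rw [hz, hdbl, add_zero]
  rcases hw with hw | hw
  · exact hpair _ (hOc.trans hw)
  · intro h
    refine hpair (w.oddColors.toFinset)ᶜ ?_ ?_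
    · have := Nat.pos_of_ne_zero (n := 2 ^ q) (by positivity)
      rw [Finset.card_compl, hcard, hOc, hw]
      omega
    · rw [← htot, ← Finset.sum_add_sum_compl w.oddColors.toFinset, h, zero_add]

end SimpleGraph

/-! ### From components to the whole graph -/

namespace SimpleGraph

variable {V : Type*} [Fintype V] (G : SimpleGraph V)

lemma exists_isVertexColouringLabelling {A : Type*} [AddCommGroup A]
    [∀ C : G.ConnectedComponent, Fintype C]
    (h : ∀ C : G.ConnectedComponent, ∃ w : C.toSimpleGraph.Coloring A,
      C.toSimpleGraph.IsBalanced w) :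
    ∃ f : G.edgeSet → A, G.IsVertexColouringLabelling f := by
  choose w hw using h
  let w' : V → A := fun v => w (G.connectedComponentMk v) ⟨v, rfl⟩
  have hw' : ∀ (C : G.ConnectedComponent) (v : C), w' v = w C v := by
    rintro C ⟨v, hv⟩
    obtain rfl : G.connectedComponentMk v = C := hv
    rfl
  obtain ⟨f, hf⟩ := G.exists_weightedDegree_eq w' fun C => by
    rw [funext (hw' C)]
    exact hw C
  refine ⟨f, fun u v huv => ?_⟩
  rw [hf]
  have hv : v ∈ G.connectedComponentMk u :=
    (ConnectedComponent.connectedComponentMk_eq_of_adj huv).symm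
  have h1 := hw' (G.connectedComponentMk u) ⟨u, rfl⟩
  have h2 := hw' (G.connectedComponentMk u) ⟨v, hv⟩
  simp only at h1 h2
  rw [h1, h2]
  exact (w _).valid huv

variable {G}

lemma HasGroupLabellings.colorable {s : ℕ} (hs : 0 < s) (h : G.HasGroupLabellings s) :
    G.Colorable s := by
  have : NeZero s := ⟨hs.ne'⟩
  obtain ⟨f, hf⟩ := h (ZMod s) (Nat.card_zmod s)
  have hcol := (Coloring.mk (G.weightedDegree f) fun {u v} huv => hf u v huv :
    G.Coloring (ZMod s)).colorable
  rwa [ZMod.card] at hcol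

/-- The colouring of a component by the weighted degrees of a vertex-colouring labelling. -/
lemma IsVertexColouringLabelling.exists_coloring {A : Type*} [AddCommGroup A]
    {f : G.edgeSet → A} (hf : G.IsVertexColouringLabelling f) (C : G.ConnectedComponent)
    [Fintype C] : ∃ (w : C.toSimpleGraph.Coloring A) (y : A), ∑ v, w v = y + y :=
  ⟨Coloring.mk (fun v : C => G.weightedDegree f v) fun {u v} huv => hf u v huv,
    G.sum_component_weightedDegree C f⟩

lemma not_hasGroupLabellings_of_forall_odd (C : G.ConnectedComponent) {k : ℕ}
    (hodd : ∀ c : C.toSimpleGraph.Coloring (Fin (4 * k + 2)), ∀ i, Odd (c.colorClass i).ncard) :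
    ¬ G.HasGroupLabellings (4 * k + 2) := by
  classical
  intro h
  obtain ⟨f, hf⟩ := h (ZMod 2 × ZMod (2 * k + 1)) (by
    rw [Nat.card_prod, Nat.card_zmod, Nat.card_zmod]
    ring)
  obtain ⟨w, y, hy⟩ := hf.exists_coloring C
  exact w.sum_ne_add_self_of_forall_odd hodd y hy

lemma not_hasGroupLabellings_of_numOddClasses (C : G.ConnectedComponent) {q : ℕ} (hq : 2 ≤ q)
    (hnum : ∀ c : C.toSimpleGraph.Coloring (Fin (2 ^ q)),
      c.numOddClasses = 2 ∨ c.numOddClasses = 2 ^ q - 2) :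
    ¬ G.HasGroupLabellings (2 ^ q) := by
  classical
  intro h
  have hcard : Nat.card (Fin q → ZMod 2) = 2 ^ q := by simp
  obtain ⟨f, hf⟩ := h (Fin q → ZMod 2) hcard
  obtain ⟨w, y, hy⟩ := hf.exists_coloring C
  have e : (Fin q → ZMod 2) ≃ Fin (2 ^ q) := Finite.equivFinOfCardEq hcard
  let c : C.toSimpleGraph.Coloring (Fin (2 ^ q)) := Coloring.mk (fun v => e (w v))
    fun hab h => w.valid hab (e.injective h)
  have hc := hnum c
  rw [w.numOddClasses_of_equiv c e fun _ => rfl] at hc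
  refine w.sum_ne_zero_of_numOddClasses hq hc (hy.trans ?_)
  funext i
  exact (by decide : ∀ a : ZMod 2, a + a = 0) (y i)

/-- Every colouring is injective, so the used classes are singletons. With `n = 2 ^ q - 2` such a
component meets the same obstruction as an ugly one, although its chromatic number is smaller. -/
lemma numOddClasses_of_iso_completeGraph {W α : Type*} [Finite α] {H : SimpleGraph W} {n : ℕ}
    (e : H ≃g completeGraph (Fin n)) (c : H.Coloring α) : c.numOddClasses = n := by
  have hinj : Function.Injective c := by
    intro u v huv
    by_contra hne
    refine c.valid (e.map_adj_iff.1 ?_) huv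
    exact fun h => hne (e.injective h)
  have : c.oddColors = Set.range c := by
    ext i
    change Odd (c.colorClass i).ncard ↔ _
    by_cases hi : i ∈ Set.range c
    · obtain ⟨v, rfl⟩ := hi
      have : c.colorClass (c v) = {v} := by
        ext u
        exact hinj.eq_iff
      simp [this]
    · exact iff_of_false (c.not_odd_of_forall_ne fun v hv => hi ⟨v, hv⟩) hi
  change c.oddColors.ncard = n
  rw [this, ← Set.image_univ, Set.ncard_image_of_injective _ hinj, Set.ncard_univ,
    Nat.card_congr e.toEquiv, Nat.card_fin]

lemma groupSumChromaticNumber_eq {n : ℕ} (hn : 0 < n) (h : G.HasGroupLabellings n)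
    (hle : ∀ m, 0 < m → G.HasGroupLabellings m → n ≤ m) : G.groupSumChromaticNumber = n :=
  le_antisymm (iInf₂_le n ⟨hn, h⟩) (le_iInf₂ fun m hm => Nat.cast_le.2 (hle m hm.1 hm.2))

end SimpleGraph

open SimpleGraph in
theorem theorem1p2 {V : Type*} [Fintype V] [Nonempty V] (G : SimpleGraph V)
    (hG : ∀ C : G.ConnectedComponent, 3 ≤ Nat.card C) :
    (((¬ ∃ C : G.ConnectedComponent, C.toSimpleGraph.IsUgly ∧
          C.toSimpleGraph.chromaticNumber = G.chromaticNumber) ∧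
        (∀ q : ℕ, 2 ≤ q → G.chromaticNumber = ((2 ^ q : ℕ) : ℕ∞) →
          ¬ ∃ C : G.ConnectedComponent,
            Nonempty (C.toSimpleGraph ≃g SimpleGraph.completeGraph (Fin (2 ^ q - 2))))) →
      G.groupSumChromaticNumber = G.chromaticNumber) ∧
    (((∃ C : G.ConnectedComponent, C.toSimpleGraph.IsUgly ∧
          C.toSimpleGraph.chromaticNumber = G.chromaticNumber) ∨
        (∃ q : ℕ, 2 ≤ q ∧ G.chromaticNumber = ((2 ^ q : ℕ) : ℕ∞) ∧
          ∃ C : G.ConnectedComponent,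
            Nonempty (C.toSimpleGraph ≃g SimpleGraph.completeGraph (Fin (2 ^ q - 2))))) →
      G.groupSumChromaticNumber = G.chromaticNumber + 1) := by
  classical
  obtain ⟨s, hs⟩ : ∃ s : ℕ, G.chromaticNumber = s :=
    ENat.ne_top_iff_exists.1 (chromaticNumber_ne_top_iff_exists.2 ⟨_, G.colorable_of_fintype⟩)
      |>.imp fun _ => Eq.symm
  have hcol : G.Colorable s := chromaticNumber_le_iff_colorable.1 hs.le
  have hpos : 0 < s := by
    have := hcol.chromaticNumber_pos
    rw [hs] at this
    exact_mod_cast this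
  have hmin : ∀ m, 0 < m → G.HasGroupLabellings m → s ≤ m := by
    intro m hm h
    have := (h.colorable hm).chromaticNumber_le
    rw [hs] at this
    exact_mod_cast this
  have hcolC : ∀ C : G.ConnectedComponent, C.toSimpleGraph.Colorable s := fun C =>
    hcol.of_hom C.toSimpleGraph_hom
  have hcard : ∀ C : G.ConnectedComponent, 3 ≤ Fintype.card C := fun C => by
    rw [← Nat.card_eq_fintype_card]
    exact hG C
  rw [hs]
  constructor
  · rintro ⟨hugly, hK⟩
    refine groupSumChromaticNumber_eq hpos (fun A _ _ hA => ?_) hmin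
    refine G.exists_isVertexColouringLabelling fun C => ?_
    refine exists_isBalanced C.connected_toSimpleGraph (hcard C) hA (hcolC C) ?_ ?_
    · exact fun h hC => hugly ⟨C, hC, h⟩
    · exact fun q hq hsq h => hK q hq (by rw [hsq]) ⟨C, h⟩
  · intro h
    -- Oddness of `s + 1` is recorded because it makes every element of a group of that order a
    -- double; it also gives `s + 1 ≥ 3`, as the bipartite components require.
    have hbad : ¬ G.HasGroupLabellings s ∧ Odd (s + 1) := by
      rcases h with ⟨C, ⟨-, -, ⟨k, hk, hodd⟩ | ⟨q, hq, hk, hnum⟩⟩, hC⟩ | ⟨q, hq, hk, C, ⟨e⟩⟩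
      · obtain rfl : s = 4 * k + 2 := by exact_mod_cast hC.symm.trans hk
        exact ⟨not_hasGroupLabellings_of_forall_odd C hodd, ⟨2 * k + 1, by ring⟩⟩
      · obtain rfl : s = 2 ^ q := by exact_mod_cast hC.symm.trans hk
        exact ⟨not_hasGroupLabellings_of_numOddClasses C hq hnum,
          ((even_two.pow_of_ne_zero (by omega)).add_one)⟩
      · obtain rfl : s = 2 ^ q := by exact_mod_cast hk
        exact ⟨not_hasGroupLabellings_of_numOddClasses C hq fun c =>
          Or.inr (numOddClasses_of_iso_completeGraph e c),
          ((even_two.pow_of_ne_zero (by omega)).add_one)⟩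
    have hgood : G.HasGroupLabellings (s + 1) := by
      intro A _ _ hA
      refine G.exists_isVertexColouringLabelling fun C => ?_
      by_cases h2 : C.toSimpleGraph.Colorable 2
      · obtain ⟨k, hk⟩ := hbad.2
        exact exists_isBalanced_of_colorable_two h2 (hcard C) (by omega)
      · exact exists_isBalanced_of_odd h2 hA hbad.2 ((hcolC C).mono (by omega))
    have := groupSumChromaticNumber_eq (Nat.succ_pos s) hgood fun m hm h =>
      Nat.lt_of_le_of_ne (hmin m hm h) fun h' => hbad.1 (h' ▸ h)
    rw [this, Nat.cast_succ]
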